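/- Notation. For $k\in\mathbb Z_{\ge 0}$ put $(\alpha;q)_k=\prod_{i=0}^{k-1}(1-\alpha q^i)$. For $0<q<1$, $0<tq<1$ and integers $0\le l\le M$, the affine $q$-Krawtchouk polynomial is $$K_l(x;t,M;q)={}_3\varphi_2\left({q^{-l},\,x,\,0\atop tq,\;q^{-M}};q,q\right)=\sum_{k=0}^{l}\frac{(q^{-l};q)_k\,(x;q)_k}{(tq;q)_k\,(q^{-M};q)_k\,(q;q)_k}\,q^k ,$$ and its orthonormal version is $$\hat K_l(x;t,M;q)=(-1)^l(tq)^{-l/2}\left(\frac{(q^{M};q^{-1})_l\,(tq;q)_l}{(q;q)_l}\right)^{1/2}K_l(x;t,M;q),$$ with the convention $\hat K_l(x;t,M;q)=0$ if $l<0$ or $l>M$. For $z\in\mathbb C\setminus[-1,1]$ let $\rho(z)=z+\sqrt{z^2-1}$, with the square root taken such that $|\rho(z)|>1$. **Proposition 7.1.** Let $c\in(0,1)$, $0<t\le 1$, $a,m\in\mathbb Z$ and let $N\ge 2$ be an integer. Put $$A=c\sqrt{t(1-tc)(1-c)(1-c^{N-1})},\qquad B=c+tc-2tc^2+tc^{1+N}.$$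 Then $A>0$, $B\in\mathbb R$, $(x-B)/(2A)\notin[-1,1]$ for every $x\in\mathbb C\setminus[0,1]$, and $$\lim_{n\to\infty}\frac{\hat K_{n+m}\bigl(x(c^{1/n})^{-nN};t,nN+a;c^{1/n}\bigr)}{\hat K_{n}\bigl(x(c^{1/n})^{-nN};t,nN+a;c^{1/n}\bigr)}=\rho\left(\frac{x-B}{2A}\right)^{m}$$ uniformly for $x$ in compact subsets of $\mathbb C\setminus[0,1]$; here, for every compact set $E\subset\mathbb C\setminus[0,1]$, the denominator has no zero in $E$ for all sufficiently large $n$. -/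

import Mathlib

open Filter Topology

noncomputable section

/-- The `q`-shifted factorial `(a;q)_k = (1 - a)(1 - aq)⋯(1 - aq^{k-1})`. -/
def qShiftedFactorial {R : Type*} [CommRing R] (a q : R) (k : ℕ) : R :=
  ∏ i ∈ Finset.range k, (1 - a * q ^ i)

/-- The affine `q`-Krawtchouk polynomial `K_l(x;t,N;q)`, `0 ≤ l ≤ N`, that is the basic
hypergeometric series `₃φ₂(q^{-l}, x, 0; tq, q^{-N}; q, q)`. The series terminates after the term
with index `l` because of the factor `(q^{-l};q)_k`. -/
def affineQKrawtchouk (l : ℕ) (x : ℂ) (t : ℝ) (N : ℤ) (q : ℝ) : ℂ :=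
  ∑ k ∈ Finset.range (l + 1),
    (qShiftedFactorial ((q : ℂ) ^ (-(l : ℤ))) (q : ℂ) k * qShiftedFactorial x (q : ℂ) k *
        qShiftedFactorial 0 (q : ℂ) k) /
      (qShiftedFactorial ((t : ℂ) * q) (q : ℂ) k * qShiftedFactorial ((q : ℂ) ^ (-N)) (q : ℂ) k *
        qShiftedFactorial (q : ℂ) (q : ℂ) k) * (q : ℂ) ^ k

/-- The orthonormal affine `q`-Krawtchouk polynomial (for `0 < q < 1`, `0 < tq < 1`)
`(-1)^l (tq)^{-l/2} √((q^N;q^{-1})_l (tq;q)_l / (q;q)_l) K_l(x;t,N;q)` if `0 ≤ l ≤ N`,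
with the convention that it is `0` if `l < 0` or `l > N`. -/
def orthonormalAffineQKrawtchouk (l : ℤ) (x : ℂ) (t : ℝ) (N : ℤ) (q : ℝ) : ℂ :=
  if 0 ≤ l ∧ l ≤ N then
    (((-1) ^ l.toNat * (t * q) ^ (-(l : ℝ) / 2) *
      √(qShiftedFactorial (q ^ N) q⁻¹ l.toNat * qShiftedFactorial (t * q) q l.toNat /
        qShiftedFactorial q q l.toNat) : ℝ) : ℂ) * affineQKrawtchouk l.toNat x t N q
  else 0

/-- With `q = c^{1/n}`, the polynomial `x ↦ K̂_l(x q^{-nN}; t, nN + a; q)`, where `K̂_l` is the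
orthonormal affine `q`-Krawtchouk polynomial. -/
def scaledQKrawtchouk (c t : ℝ) (N : ℕ) (a : ℤ) (n : ℕ) (l : ℤ) (x : ℂ) : ℂ :=
  orthonormalAffineQKrawtchouk l
    (x * ((c ^ (1 / (n : ℝ)) : ℝ) : ℂ) ^ (-((n : ℤ) * (N : ℤ)))) t
    ((n : ℤ) * (N : ℤ) + a) (c ^ (1 / (n : ℝ)))

/-- `ρ(z) = z + √(z² - 1)`, where that square root of `z² - 1` is taken for which `|ρ(z)| > 1`
if `z ∉ [-1,1]`. -/
def joukowskiRho (z : ℂ) : ℂ :=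
  if 1 < ‖z + (z ^ 2 - 1) ^ (1 / 2 : ℂ)‖ then z + (z ^ 2 - 1) ^ (1 / 2 : ℂ)
  else z - (z ^ 2 - 1) ^ (1 / 2 : ℂ)

/-- The choice of the root in `joukowskiRho` is the intended one. -/
theorem joukowskiRho_spec (z : ℂ) (hz : z ∉ Complex.ofReal '' Set.Icc (-1) 1) :
    1 < ‖joukowskiRho z‖ ∧ (joukowskiRho z - z) ^ 2 = z ^ 2 - 1 := by
  obtain ⟨s, hs⟩ : ∃ s, s = (z ^ 2 - 1) ^ (1 / 2 : ℂ) := ⟨_, rfl⟩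
  have hs2 : s ^ 2 = z ^ 2 - 1 := by
    rw [hs, one_div]
    have h := Complex.cpow_nat_inv_pow (z ^ 2 - 1) (n := 2) (by norm_num)
    rwa [Nat.cast_ofNat] at h
  unfold joukowskiRho
  rw [← hs]
  split_ifs with h
  · exact ⟨h, by rw [← hs2]; ring⟩
  · refine ⟨?_, by rw [← hs2]; ring⟩
    by_contra h'
    apply hz
    push Not at h h'
    have hp : (z + s) * (z - s) = 1 := by linear_combination -hs2
    have hn : ‖z + s‖ * ‖z - s‖ = 1 := by rw [← norm_mul, hp, norm_one]
    have h1 : ‖z + s‖ = 1 := by nlinarith [norm_nonneg (z + s), norm_nonneg (z - s)]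
    have hc : z - s = (starRingEnd ℂ) (z + s) := by
      have h2 : (z + s) * (starRingEnd ℂ) (z + s) = 1 := by
        rw [Complex.mul_conj, Complex.normSq_eq_norm_sq, h1]; norm_num
      have h3 : z + s ≠ 0 := by intro h4; rw [h4] at hp; simp at hp
      exact mul_left_cancel₀ h3 (hp.trans h2.symm)
    have hz2 : z = ((z + s).re : ℂ) := by
      have h5 := Complex.add_conj (z + s)
      rw [← hc] at h5
      push_cast at h5 ⊢
      linear_combination h5 / 2
    refine ⟨(z + s).re, ?_, hz2.symm⟩
    have := Complex.abs_re_le_norm (z + s)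
    rw [h1] at this
    exact abs_le.mp this

end

/-!
The orthonormal affine `q`-Krawtchouk polynomials `p_k`, in the scaled variable `x`, satisfy a
three-term recurrence `a_{k+1} p_{k+1} = (x - b_k) p_k - a_k p_{k-1}` with real coefficients
(`orthonormalAffineQKrawtchouk_recurrence`). With `q = c^{1/n}`, the coefficients whose index is at
bounded distance from `n` converge to `A` and `B` (`tendsto_krawtchouk_coefficients`), so that locally
the recurrence is a perturbation of one with constant coefficients, whose characteristic roots are
`ρ` and `ρ⁻¹` with `A (ρ + ρ⁻¹) = x - B`. It remains to see that the growing root `ρ` governs the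
ratios.

This follows from an a priori bound that replaces the location of zeros and normal families. The
Jacobi matrix has its quadratic form between `0` and `D = q^{-a}`, since its off-diagonal entries
factor in two ways that turn the form and its complement to `D` into sums of squares. Testing
`x - J` on the vector `(p_0, …, p_l)` gives `(x - h) ∑_{k ≤ l} |p_k|² = a_{l+1} p_{l+1} conj p_l` for
some `h ∈ [0, D]`. As `D → 1`, for `x` at distance at least `δ` from `[0, 1]` this shows
`p_{l+1} ≠ 0` and `|p_k| ≤ C |p_{l+1}|` for all `k ≤ l`, with `C` depending only on `δ` and `A`
(`norm_le_of_jacobi_recurrence`). Hence `d_i = (p_{i+1} - ρ p_i) / p_n` is bounded for `i < n`, and since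
`d_i = ρ⁻¹ d_{i-1} + o(1)` with `|ρ⁻¹|` bounded away from `1`, it tends to `0` at `i = n`
(`tendsto_ratio_div_of_recurrence`). Uniformity in `x ∈ K` is built in by taking all limits along the
filter `atTop ×ˢ 𝓟 K`.
-/

/-! ### Solutions of Jacobi recurrences -/

/-- Solutions of a Jacobi recurrence: `x S = h + a_{l+1} p_{l+1} conj p_l` with `S = ∑_{k ≤ l} |p_k|²`,
where `h` is the quadratic form of the truncated Jacobi matrix at `(p_0, …, p_l)`. The two
factorizations of the off-diagonal entries `a_{k+1}` write `h` and `D S - h` as sums of squares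
`|α_k p_k + β_{k+1} p_{k+1}|²` and `|γ_k p_k - η_{k+1} p_{k+1}|²` plus nonnegative terms, so that
`0 ≤ h ≤ D S`. The value of `p (0 - 1)` is irrelevant because `a 0 = 0`. -/
theorem exists_real_sub_mul_sum_normSq_eq {p : ℕ → ℂ} {a b : ℕ → ℝ} {α β γ η : ℕ → ℝ} {D : ℝ}
    {x : ℂ} {L : ℕ} (ha0 : a 0 = 0)
    (hrec : ∀ k < L, (a (k + 1) : ℂ) * p (k + 1) = (x - b k) * p k - a k * p (k - 1))
    (hαβ : ∀ k < L, a (k + 1) = α k * β (k + 1)) (hγη : ∀ k < L, a (k + 1) = γ k * η (k + 1))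
    (hlow : ∀ k ≤ L, α k ^ 2 + β k ^ 2 ≤ b k) (hupp : ∀ k ≤ L, γ k ^ 2 + η k ^ 2 ≤ D - b k)
    {l : ℕ} (hl : l < L) :
    ∃ h : ℝ, α l ^ 2 * ‖p l‖ ^ 2 ≤ h ∧
      γ l ^ 2 * ‖p l‖ ^ 2 ≤ D * (∑ k ∈ Finset.range (l + 1), ‖p k‖ ^ 2) - h ∧
      x * ((∑ k ∈ Finset.range (l + 1), ‖p k‖ ^ 2 : ℝ) : ℂ) - h =
        a (l + 1) * p (l + 1) * (starRingEnd ℂ) (p l) := by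
  have key : ∀ z : ℂ, ((‖z‖ ^ 2 : ℝ) : ℂ) = z * (starRingEnd ℂ) z := fun z => by
    rw [Complex.mul_conj, Complex.normSq_eq_norm_sq]
  -- Expansion of `|u z + v w|²` for real `u`, `v`, whose cross term is the off-diagonal entry.
  have sq_exp : ∀ (u v : ℝ) (z w : ℂ), 0 ≤ u ^ 2 * ‖z‖ ^ 2 +
      u * v * (z * (starRingEnd ℂ) w + w * (starRingEnd ℂ) z).re + v ^ 2 * ‖w‖ ^ 2 := by
    intro u v z w
    have h : u ^ 2 * ‖z‖ ^ 2 + u * v * (z * (starRingEnd ℂ) w + w * (starRingEnd ℂ) z).re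
        + v ^ 2 * ‖w‖ ^ 2 = (u * z.re + v * w.re) ^ 2 + (u * z.im + v * w.im) ^ 2 := by
      rw [← Complex.normSq_eq_norm_sq, ← Complex.normSq_eq_norm_sq, Complex.normSq_apply,
        Complex.normSq_apply]
      simp only [Complex.add_re, Complex.mul_re, Complex.conj_re, Complex.conj_im]
      ring
    rw [h]; positivity
  induction l with
  | zero =>
    refine ⟨b 0 * ‖p 0‖ ^ 2, ?_, ?_, ?_⟩
    · have := hlow 0 (by omega)
      nlinarith [sq_nonneg (β 0), sq_nonneg ‖p 0‖]
    · have := hupp 0 (by omega)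
      simp only [zero_add, Finset.range_one, Finset.sum_singleton]
      nlinarith [sq_nonneg (η 0), sq_nonneg ‖p 0‖]
    · rw [hrec 0 hl]
      simp only [zero_add, Finset.range_one, Finset.sum_singleton, ha0]
      push_cast
      have := key (p 0)
      push_cast at this
      rw [this]; ring
  | succ l ih =>
    obtain ⟨h, h1, h2, h3⟩ := ih (by omega)
    set z := p l
    set w := p (l + 1)
    set X := (z * (starRingEnd ℂ) w + w * (starRingEnd ℂ) z).re with hX
    have hXc : (X : ℂ) = z * (starRingEnd ℂ) w + w * (starRingEnd ℂ) z := by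
      apply Complex.ext
      · simp [hX]
      · simp; ring
    refine ⟨h + a (l + 1) * X + b (l + 1) * ‖w‖ ^ 2, ?_, ?_, ?_⟩
    · have e1 := sq_exp (α l) (β (l + 1)) z w
      rw [← hαβ l (by omega), ← hX] at e1
      have e2 := mul_le_mul_of_nonneg_right (hlow (l + 1) (by omega)) (sq_nonneg ‖w‖)
      linarith
    · have e1 := sq_exp (γ l) (-η (l + 1)) z w
      rw [mul_neg, ← hγη l (by omega), ← hX] at e1
      have e2 := mul_le_mul_of_nonneg_right (hupp (l + 1) (by omega)) (sq_nonneg ‖w‖)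
      rw [Finset.sum_range_succ]
      linarith
    · rw [Finset.sum_range_succ, hrec (l + 1) hl]
      have hk := key w
      simp only [add_tsub_cancel_right]
      rw [Complex.ofReal_add, Complex.ofReal_add, Complex.ofReal_add, Complex.ofReal_mul,
        Complex.ofReal_mul, hXc, hk]
      linear_combination h3

/-- If `x` has distance at least `δ` from `[0, D]`, which contains the numerical range of the
Jacobi matrix, then no solution value vanishes at `x` and each one dominates all previous ones. -/
theorem norm_le_of_jacobi_recurrence {p : ℕ → ℂ} {a b : ℕ → ℝ} {α β γ η : ℕ → ℝ} {D δ : ℝ}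
    {x : ℂ} {L : ℕ} (ha0 : a 0 = 0) (hp0 : p 0 ≠ 0)
    (hrec : ∀ k < L, (a (k + 1) : ℂ) * p (k + 1) = (x - b k) * p k - a k * p (k - 1))
    (hαβ : ∀ k < L, a (k + 1) = α k * β (k + 1)) (hγη : ∀ k < L, a (k + 1) = γ k * η (k + 1))
    (hlow : ∀ k ≤ L, α k ^ 2 + β k ^ 2 ≤ b k) (hupp : ∀ k ≤ L, γ k ^ 2 + η k ^ 2 ≤ D - b k)
    (hδ : 0 < δ) (hx : ∀ h ∈ Set.Icc 0 D, δ ≤ ‖x - (h : ℂ)‖) {l : ℕ} (hl : l < L) :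
    p (l + 1) ≠ 0 ∧ ∀ k ≤ l, δ * ‖p k‖ ≤ |a (l + 1)| * ‖p (l + 1)‖ := by
  obtain ⟨h, h1, h2, h3⟩ :=
    exists_real_sub_mul_sum_normSq_eq ha0 hrec hαβ hγη hlow hupp hl
  set S := ∑ k ∈ Finset.range (l + 1), ‖p k‖ ^ 2 with hS
  have hle : ∀ k ≤ l, ‖p k‖ ^ 2 ≤ S := fun k hk =>
    Finset.single_le_sum (f := fun k => ‖p k‖ ^ 2) (fun i _ => sq_nonneg _)
      (Finset.mem_range.2 (by omega))
  have hSpos : 0 < S := lt_of_lt_of_le (by positivity) (hle 0 (by omega))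
  have hh0 : 0 ≤ h := le_trans (by positivity) h1
  have hhD : h ≤ D * S := by
    have : 0 ≤ γ l ^ 2 * ‖p l‖ ^ 2 := by positivity
    linarith
  have hdist := hx (h / S) ⟨by positivity, (div_le_iff₀ hSpos).2 hhD⟩
  have hmain : δ * S ≤ |a (l + 1)| * ‖p (l + 1)‖ * ‖p l‖ := by
    have e : (x - ((h / S : ℝ) : ℂ)) * (S : ℂ) = a (l + 1) * p (l + 1) * (starRingEnd ℂ) (p l) := by
      rw [← h3]
      have : (S : ℂ) ≠ 0 := by exact_mod_cast hSpos.ne'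
      push_cast
      field_simp
    have e2 := congrArg norm e
    rw [norm_mul, norm_mul, norm_mul, RCLike.norm_conj, Complex.norm_real, Complex.norm_real,
      Real.norm_eq_abs, Real.norm_eq_abs, abs_of_pos hSpos] at e2
    rw [← e2]
    exact mul_le_mul_of_nonneg_right hdist hSpos.le
  have hpos : 0 < |a (l + 1)| * ‖p (l + 1)‖ * ‖p l‖ := lt_of_lt_of_le (by positivity) hmain
  have hpl : 0 < ‖p l‖ := by
    rcases (norm_nonneg (p l)).eq_or_lt with h0 | h0
    · rw [← h0, mul_zero] at hpos; exact absurd hpos (lt_irrefl _)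
    · exact h0
  refine ⟨fun h0 => by simp [h0] at hpos, fun k hk => ?_⟩
  set T := |a (l + 1)| * ‖p (l + 1)‖
  have hl' : δ * ‖p l‖ ≤ T := by
    have := hle l le_rfl
    refine le_of_mul_le_mul_right ?_ hpl
    nlinarith
  have hT : 0 ≤ T := by positivity
  refine abs_le_of_sq_le_sq' ?_ hT |>.2
  have hk' := mul_le_mul_of_nonneg_left (hle k hk) (sq_nonneg δ)
  nlinarith

/-! ### Ratio asymptotics for converging coefficients -/

/-- A family that is bounded in the past and satisfies `d_i = σ d_{i-1} + o(1)` with `|σ| ≤ s < 1` tends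
to zero: iterating `J` times leaves `σ^J d_{j-J} + o(1)`. -/
theorem tendsto_zero_of_approx_contraction {Ω : Type*} {F : Filter Ω} {d : ℤ → Ω → ℂ}
    {σ : Ω → ℂ} {s C : ℝ} {j : ℤ} (hs0 : 0 ≤ s) (hs : s < 1) (hσ : ∀ᶠ ω in F, ‖σ ω‖ ≤ s)
    (hd : ∀ i < j, ∀ᶠ ω in F, ‖d i ω‖ ≤ C)
    (hstep : ∀ i ≤ j, Tendsto (fun ω => d i ω - σ ω * d (i - 1) ω) F (𝓝 0)) :
    Tendsto (d j) F (𝓝 0) := by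
  have hiter : ∀ J : ℕ, Tendsto (fun ω => d j ω - σ ω ^ J * d (j - J) ω) F (𝓝 0) := by
    intro J
    induction J with
    | zero => simp [tendsto_const_nhds]
    | succ J ih =>
      have h1 : Tendsto (fun ω => σ ω ^ J * (d (j - J) ω - σ ω * d (j - J - 1) ω)) F (𝓝 0) := by
        refine squeeze_zero_norm' ?_ (tendsto_zero_iff_norm_tendsto_zero.1 (hstep (j - J) (by omega)))
        filter_upwards [hσ] with ω hω
        rw [norm_mul, norm_pow]
        exact mul_le_of_le_one_left (norm_nonneg _)
          (pow_le_one₀ (norm_nonneg _) (hω.trans hs.le))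
      rw [← add_zero (0 : ℂ)]
      refine (ih.add h1).congr fun ω => ?_
      have : j - ((J + 1 : ℕ) : ℤ) = j - J - 1 := by push_cast; ring
      rw [this]; ring
  rw [NormedAddGroup.tendsto_nhds_zero]
  intro ε hε
  have hlim : Tendsto (fun J : ℕ => s ^ J * C) atTop (𝓝 (0 * C)) :=
    (tendsto_pow_atTop_nhds_zero_of_lt_one hs0 hs).mul_const C
  rw [zero_mul] at hlim
  obtain ⟨J, hJ, hJ1⟩ :=
    ((hlim.eventually_lt_const (half_pos hε)).and (eventually_ge_atTop 1)).exists
  filter_upwards [hσ, hd (j - J) (by omega),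
    NormedAddGroup.tendsto_nhds_zero.1 (hiter J) (ε / 2) (half_pos hε)] with ω h1 h2 h3
  calc ‖d j ω‖ = ‖(d j ω - σ ω ^ J * d (j - J) ω) + σ ω ^ J * d (j - J) ω‖ := by ring_nf
    _ ≤ ‖d j ω - σ ω ^ J * d (j - J) ω‖ + ‖σ ω ^ J * d (j - J) ω‖ := norm_add_le _ _
    _ < ε / 2 + ε / 2 := by
      refine add_lt_add h3 (lt_of_le_of_lt ?_ hJ)
      rw [norm_mul, norm_pow]
      gcongr
    _ = ε := add_halves ε

/-- Ratio asymptotics for a three-term recurrence whose coefficients converge to `A` and `B`. With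
`u_i = p_i / p_j`, the differences `d_i = u_{i+1} - ρ u_i` satisfy `d_i = ρ⁻¹ d_{i-1} + o(1)`; the
boundedness of the `u_i` in the past rules out the solution growing like `ρ^{-i}` there. -/
theorem tendsto_ratio_div_of_recurrence {Ω : Type*} {F : Filter Ω} {p : ℤ → Ω → ℂ}
    {a b : ℤ → Ω → ℝ} {X ρ : Ω → ℂ} {A B C R R' C' : ℝ} (hA : 0 < A)
    (ha : ∀ j, Tendsto (a j) F (𝓝 A)) (hb : ∀ j, Tendsto (b j) F (𝓝 B))
    (hX : ∀ᶠ ω in F, ‖X ω‖ ≤ C') (hR : 1 < R) (hρ : ∀ᶠ ω in F, R ≤ ‖ρ ω‖ ∧ ‖ρ ω‖ ≤ R')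
    (hρX : ∀ᶠ ω in F, A * (ρ ω + (ρ ω)⁻¹) = X ω - B)
    (hrec : ∀ j, ∀ᶠ ω in F,
      (a (j + 1) ω : ℂ) * p (j + 1) ω = (X ω - b j ω) * p j ω - a j ω * p (j - 1) ω)
    (hbd : ∀ i j, i < j → ∀ᶠ ω in F, ‖p i ω‖ ≤ C * ‖p j ω‖)
    (hne : ∀ j, ∀ᶠ ω in F, p j ω ≠ 0) (j : ℤ) :
    Tendsto (fun ω => p (j + 1) ω / p j ω / ρ ω) F (𝓝 1) := by
  set u : ℤ → Ω → ℂ := fun i ω => p i ω / p j ω with hu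
  have hrecu : ∀ i, ∀ᶠ ω in F,
      (a (i + 1) ω : ℂ) * u (i + 1) ω = (X ω - b i ω) * u i ω - a i ω * u (i - 1) ω := by
    intro i
    filter_upwards [hrec i, hne j] with ω h1 h2
    simp only [hu]
    field_simp
    linear_combination h1
  have huj : ∀ᶠ ω in F, u j ω = 1 := by
    filter_upwards [hne j] with ω h
    exact div_self h
  have hule : ∀ i < j, ∀ᶠ ω in F, ‖u i ω‖ ≤ C := by
    intro i hi
    filter_upwards [hbd i j hi, hne j] with ω h1 h2
    simp only [hu]
    rw [norm_div, div_le_iff₀ (norm_pos_iff.2 h2)]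
    exact h1
  have hubd : ∀ i ≤ j + 1, F.IsBoundedUnder (· ≤ ·) fun ω => ‖u i ω‖ := by
    intro i hi
    rcases lt_trichotomy i j with h | h | h
    · exact ⟨C, by simpa using hule i h⟩
    · subst h
      exact ⟨1, by simpa using huj.mono fun ω h => by rw [h]; simp⟩
    · obtain rfl : i = j + 1 := by omega
      refine ⟨(C' + (|B| + 1) + (A + 1) * C) / (A / 2), ?_⟩
      rw [eventually_map]
      filter_upwards [hrecu j, huj, hule (j - 1) (by omega), hX,
        (ha (j + 1)).eventually_const_lt (half_lt_self hA), (ha j).eventually_lt_const (lt_add_one A),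
        (ha j).eventually_const_lt hA, (hb j).abs.eventually_lt_const (lt_add_one |B|)]
        with ω h1 h2 h3 h4 h5 h6 h7 h8
      rw [h2, mul_one] at h1
      rw [le_div_iff₀ (by positivity)]
      have e := congrArg norm h1
      rw [norm_mul, Complex.norm_real, Real.norm_eq_abs, abs_of_pos (by linarith)] at e
      have e1 : ‖X ω - b j ω - a j ω * u (j - 1) ω‖ ≤ ‖X ω‖ + |b j ω| + a j ω * ‖u (j - 1) ω‖ := by
        refine (norm_sub_le _ _).trans (add_le_add ((norm_sub_le _ _).trans ?_) ?_)
        · simp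
        · rw [norm_mul, Complex.norm_real, Real.norm_eq_abs, abs_of_pos h7]
      have e2 : a j ω * ‖u (j - 1) ω‖ ≤ (A + 1) * C :=
        mul_le_mul h6.le h3 (norm_nonneg _) (by linarith)
      nlinarith [norm_nonneg (u (j + 1) ω)]
  -- Replacing a coefficient by its limit costs only `o(1)`.
  have hsmall : ∀ (v : Ω → ℝ) (V : ℝ) (i : ℤ), i ≤ j + 1 → Tendsto v F (𝓝 V) →
      Tendsto (fun ω => ((V - v ω : ℝ) : ℂ) * u i ω) F (𝓝 0) := by
    intro v V i hi hv
    have h0 : Tendsto (fun ω => ((V - v ω : ℝ) : ℂ)) F (𝓝 0) := by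
      have := (Complex.continuous_ofReal.tendsto _).comp (hv.const_sub V)
      simpa [Function.comp_def] using this
    exact h0.zero_mul_isBoundedUnder_le (hubd i hi)
  have hd : Tendsto (fun ω => u (j + 1) ω - ρ ω * u j ω) F (𝓝 0) := by
    have hR0 : 0 < R := one_pos.trans hR
    refine tendsto_zero_of_approx_contraction (d := fun i ω => u (i + 1) ω - ρ ω * u i ω)
      (σ := fun ω => (ρ ω)⁻¹) (s := R⁻¹) (C := max C 1 + R' * C) (j := j)
      (inv_nonneg.2 hR0.le) (inv_lt_one_of_one_lt₀ hR) ?_ ?_ ?_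
    · filter_upwards [hρ] with ω h
      rw [norm_inv]
      exact inv_anti₀ hR0 h.1
    · intro i hi
      have h1 : ∀ᶠ ω in F, ‖u (i + 1) ω‖ ≤ max C 1 := by
        rcases (show i + 1 ≤ j by omega).lt_or_eq with h | h
        · filter_upwards [hule (i + 1) h] with ω h' using h'.trans (le_max_left _ _)
        · rw [h]
          filter_upwards [huj] with ω h'
          rw [h', norm_one]; exact le_max_right _ _
      filter_upwards [h1, hule i hi, hρ] with ω h1 h2 h3
      refine (norm_sub_le _ _).trans (add_le_add h1 ?_)
      rw [norm_mul]
      exact mul_le_mul h3.2 h2 (norm_nonneg _) ((norm_nonneg _).trans h3.2)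
    · intro i hi
      have h := ((hsmall (a (i + 1)) A (i + 1) (by omega) (ha (i + 1))).add
        (hsmall (a i) A (i - 1) (by omega) (ha i))).add (hsmall (b i) B i (by omega) (hb i))
      have h' := h.const_mul ((A : ℂ)⁻¹)
      simp only [add_zero, mul_zero] at h'
      refine h'.congr' ?_
      filter_upwards [hrecu i, hρX, hρ] with ω h1 h2 h3
      have hρ0 : ρ ω ≠ 0 := norm_pos_iff.1 (hR0.trans_le h3.1)
      have hA0 : (A : ℂ) ≠ 0 := by exact_mod_cast hA.ne'
      rw [inv_mul_eq_iff_eq_mul₀ hA0, sub_add_cancel]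
      push_cast
      linear_combination (-1 : ℂ) * h1 + u i ω * h2 - A * u (i - 1) ω * mul_inv_cancel₀ hρ0
  have hinv : F.IsBoundedUnder (· ≤ ·) (norm ∘ fun ω => (ρ ω)⁻¹) := by
    refine ⟨1, ?_⟩
    rw [eventually_map]
    filter_upwards [hρ] with ω h
    simp only [Function.comp_apply, norm_inv]
    exact inv_le_one_of_one_le₀ (hR.le.trans h.1)
  have h := (hd.zero_mul_isBoundedUnder_le hinv).add_const 1
  rw [zero_add] at h
  refine h.congr' ?_
  filter_upwards [huj, hρ] with ω h1 h2
  have hρ0 : ρ ω ≠ 0 := norm_pos_iff.1 (one_pos.trans (hR.trans_le h2.1))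
  rw [h1]
  simp only [hu]
  field_simp
  ring

theorem tendsto_ratio_div_zpow {Ω : Type*} {F : Filter Ω} {p : ℤ → Ω → ℂ} {ρ : Ω → ℂ}
    (hne : ∀ j, ∀ᶠ ω in F, p j ω ≠ 0) (hρ : ∀ᶠ ω in F, ρ ω ≠ 0)
    (h : ∀ j, Tendsto (fun ω => p (j + 1) ω / p j ω / ρ ω) F (𝓝 1)) (m : ℤ) :
    Tendsto (fun ω => p m ω / p 0 ω / ρ ω ^ m) F (𝓝 1) := by
  induction m with
  | zero =>
    refine tendsto_const_nhds.congr' ?_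
    filter_upwards [hne 0] with ω h0
    simp [h0]
  | succ i ih =>
    have := ih.mul (h i)
    rw [one_mul] at this
    refine this.congr' ?_
    filter_upwards [hne 0, hne i, hρ] with ω h0 h1 h2
    rw [zpow_add_one₀ h2]
    field_simp
  | pred i ih =>
    have := ih.div (h (-i - 1)) one_ne_zero
    rw [one_div_one] at this
    refine this.congr' ?_
    filter_upwards [hne 0, hne (-i), hne (-i - 1), hρ] with ω h0 h1 h2 h3
    rw [Pi.div_apply, sub_add_cancel, zpow_sub_one₀ h3]
    field_simp

/-! ### The recurrence of the affine `q`-Krawtchouk polynomials -/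

theorem qShiftedFactorial_zero_right {R : Type*} [CommRing R] (a q : R) :
    qShiftedFactorial a q 0 = 1 := by
  simp [qShiftedFactorial]

theorem qShiftedFactorial_succ {R : Type*} [CommRing R] (a q : R) (k : ℕ) :
    qShiftedFactorial a q (k + 1) = qShiftedFactorial a q k * (1 - a * q ^ k) :=
  Finset.prod_range_succ _ _

theorem qShiftedFactorial_succ' {R : Type*} [CommRing R] (a q : R) (k : ℕ) :
    qShiftedFactorial a q (k + 1) = (1 - a) * qShiftedFactorial (a * q) q k := by
  unfold qShiftedFactorial
  rw [Finset.prod_range_succ', mul_comm]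
  simp [pow_succ', mul_assoc]

theorem qShiftedFactorial_zero_left {R : Type*} [CommRing R] (q : R) (k : ℕ) :
    qShiftedFactorial 0 q k = 1 := by
  simp [qShiftedFactorial]

theorem qShiftedFactorial_eq_zero {R : Type*} [CommRing R] {a q : R} {i k : ℕ} (h : a * q ^ i = 1)
    (hik : i < k) : qShiftedFactorial a q k = 0 :=
  Finset.prod_eq_zero (Finset.mem_range.2 hik) (by rw [h, sub_self])

theorem qShiftedFactorial_ne_zero {R : Type*} [CommRing R] [IsDomain R] {a q : R} {k : ℕ}
    (h : ∀ i < k, a * q ^ i ≠ 1) : qShiftedFactorial a q k ≠ 0 :=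
  Finset.prod_ne_zero_iff.2 fun i hi => sub_ne_zero.2 (h i (Finset.mem_range.1 hi)).symm

/-- The sum of the first `L` terms of the series `₃φ₂(r, y, 0; τ, μ; q, q)`. Unlike in
`affineQKrawtchouk`, the truncation does not depend on `r`, so that sums with different `r` can be
compared termwise. -/
noncomputable def phiPartialSum (r τ μ q y : ℂ) (L : ℕ) : ℂ :=
  ∑ k ∈ Finset.range L, qShiftedFactorial r q k * qShiftedFactorial y q k /
    (qShiftedFactorial τ q k * qShiftedFactorial μ q k * qShiftedFactorial q q k) * q ^ k

/-- The `q`-difference relation in `r` (with `r = q^{-l}` it is the three-term recurrence in the degree),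
proved by comparing coefficients in the basis `(y;q)_k`, on which multiplication by `y` acts through
`y (y;q)_k = q^{-k} ((y;q)_k - (y;q)_{k+1})`. -/
theorem phiPartialSum_contiguous {r τ μ q y : ℂ} {l : ℕ} (hr : r ≠ 0) (hq : q ≠ 0)
    (hlast : qShiftedFactorial r q (l + 1) = 0)
    (hden : qShiftedFactorial τ q (l + 1) * qShiftedFactorial μ q (l + 1) *
      qShiftedFactorial q q (l + 1) ≠ 0) :
    (y - 1) * phiPartialSum r τ μ q y (l + 2) =
      (1 - μ / r) * (1 - τ / r) *
        (phiPartialSum (r / q) τ μ q y (l + 2) - phiPartialSum r τ μ q y (l + 2)) +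
      τ / q * (μ / r) * (1 - 1 / r) *
        (phiPartialSum r τ μ q y (l + 2) - phiPartialSum (r * q) τ μ q y (l + 2)) := by
  set den : ℕ → ℂ := fun k =>
    qShiftedFactorial τ q k * qShiftedFactorial μ q k * qShiftedFactorial q q k with hdendef
  have hden_succ : ∀ k, den (k + 1) =
      den k * ((1 - τ * q ^ k) * (1 - μ * q ^ k) * (1 - q ^ (k + 1))) := fun k => by
    simp only [hdendef, qShiftedFactorial_succ]; ring
  have hden_ne : ∀ k ≤ l + 1, den k ≠ 0 := by
    intro k hk
    induction hk using Nat.decreasingInduction with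
    | self => exact hden
    | of_succ k hk ih =>
      rw [hden_succ] at ih
      exact left_ne_zero_of_mul ih
  -- Comparison of the coefficients of `(y;q)_{k+1}`.
  have hcoef : ∀ k < l + 1,
      qShiftedFactorial r q (k + 1) / den (k + 1) * q ^ (k + 1) * ((q ^ (k + 1))⁻¹ - 1) -
        qShiftedFactorial r q k / den k * q ^ k * (q ^ k)⁻¹ =
      (1 - μ / r) * (1 - τ / r) * (qShiftedFactorial (r / q) q (k + 1) / den (k + 1) * q ^ (k + 1)
        - qShiftedFactorial r q (k + 1) / den (k + 1) * q ^ (k + 1)) +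
      τ / q * (μ / r) * (1 - 1 / r) * (qShiftedFactorial r q (k + 1) / den (k + 1) * q ^ (k + 1)
        - qShiftedFactorial (r * q) q (k + 1) / den (k + 1) * q ^ (k + 1)) := by
    intro k hk
    have h1 := hden_ne (k + 1) (by omega)
    rw [hden_succ] at h1 ⊢
    have h0 := left_ne_zero_of_mul h1
    have h2 := right_ne_zero_of_mul h1
    have hτ := left_ne_zero_of_mul (left_ne_zero_of_mul h2)
    have hμ := right_ne_zero_of_mul (left_ne_zero_of_mul h2)
    have hqq := right_ne_zero_of_mul h2
    have e1 : qShiftedFactorial r q k * (1 - r * q ^ k) =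
        (1 - r) * qShiftedFactorial (r * q) q k := by
      rw [← qShiftedFactorial_succ, qShiftedFactorial_succ']
    rw [qShiftedFactorial_succ' (r / q), div_mul_cancel₀ r hq, qShiftedFactorial_succ (r * q),
      qShiftedFactorial_succ r]
    generalize qShiftedFactorial r q k = e at *
    generalize qShiftedFactorial (r * q) q k = f at *
    have hqk : q ^ k ≠ 0 := pow_ne_zero _ hq
    rw [pow_succ] at *
    generalize q ^ k = Q at *
    generalize den k = d at *
    have hC : τ / q * (μ / r) * (1 - 1 / r) * (e * (1 - r * Q) - f * (1 - r * q * Q)) =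
        τ / q * (μ / r) * (e * (1 - r * Q) * (1 - Q * q)) := by
      rw [mul_assoc]
      congr 1
      field_simp
      linear_combination -(1 - r * q * Q) * e1
    have hA : (1 - μ / r) * (1 - τ / r) * ((1 - r / q) * e - e * (1 - r * Q)) =
        (1 - μ / r) * (1 - τ / r) * (e * (r / q) * (Q * q - 1)) := by
      field_simp
      ring
    have hmul : (e * (1 - r * Q)) * (1 - Q * q) -
        e * ((1 - τ * Q) * (1 - μ * Q) * (1 - Q * q)) =
        (1 - μ / r) * (1 - τ / r) * ((1 - r / q) * e - e * (1 - r * Q)) * (Q * q) +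
        τ / q * (μ / r) * (1 - 1 / r) * (e * (1 - r * Q) - f * (1 - r * q * Q)) * (Q * q) := by
      rw [hC, hA]
      field_simp
      ring
    have hl : e * (1 - r * Q) / (d * ((1 - τ * Q) * (1 - μ * Q) * (1 - Q * q))) * (Q * q) *
        ((Q * q)⁻¹ - 1) - e / d * Q * Q⁻¹ = ((e * (1 - r * Q)) * (1 - Q * q) -
        e * ((1 - τ * Q) * (1 - μ * Q) * (1 - Q * q))) /
          (d * ((1 - τ * Q) * (1 - μ * Q) * (1 - Q * q))) := by
      rw [eq_div_iff h1, sub_mul, mul_assoc (_ / _), ← mul_div_right_comm, div_mul_cancel₀ _ h1]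
      field_simp
    rw [hl, hmul]
    ring
  have hexp : ∀ s : ℂ, phiPartialSum s τ μ q y (l + 2) =
      ∑ k ∈ Finset.range (l + 1), qShiftedFactorial s q (k + 1) / den (k + 1) * q ^ (k + 1) *
        qShiftedFactorial y q (k + 1) + 1 := by
    intro s
    rw [phiPartialSum, Finset.sum_range_succ']
    congr 1
    · exact Finset.sum_congr rfl fun k _ => by ring
    · simp [qShiftedFactorial_zero_right]
  have hlhs : (y - 1) * phiPartialSum r τ μ q y (l + 2) =
      ∑ k ∈ Finset.range (l + 1),
        (qShiftedFactorial r q (k + 1) / den (k + 1) * q ^ (k + 1) * ((q ^ (k + 1))⁻¹ - 1) -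
          qShiftedFactorial r q k / den k * q ^ k * (q ^ k)⁻¹) *
          qShiftedFactorial y q (k + 1) := by
    have h : (y - 1) * phiPartialSum r τ μ q y (l + 2) =
        ∑ k ∈ Finset.range (l + 2), qShiftedFactorial r q k / den k * q ^ k *
          ((q ^ k)⁻¹ - 1) * qShiftedFactorial y q k -
        ∑ k ∈ Finset.range (l + 2), qShiftedFactorial r q k / den k * q ^ k *
          (q ^ k)⁻¹ * qShiftedFactorial y q (k + 1) := by
      rw [phiPartialSum, Finset.mul_sum, ← Finset.sum_sub_distrib]
      refine Finset.sum_congr rfl fun k _ => ?_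
      have hqk : q ^ k ≠ 0 := pow_ne_zero _ hq
      rw [qShiftedFactorial_succ y]
      field_simp
      ring
    rw [h, Finset.sum_range_succ', Finset.sum_range_succ _ (l + 1), hlast]
    simp only [pow_zero, inv_one, sub_self, mul_zero, zero_mul, add_zero, zero_div]
    rw [← Finset.sum_sub_distrib]
    exact Finset.sum_congr rfl fun k _ => by ring
  rw [hlhs, hexp, hexp, hexp, add_sub_add_right_eq_sub, add_sub_add_right_eq_sub,
    ← Finset.sum_sub_distrib, ← Finset.sum_sub_distrib, Finset.mul_sum, Finset.mul_sum,
    ← Finset.sum_add_distrib]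
  refine Finset.sum_congr rfl fun k hk => ?_
  rw [hcoef k (Finset.mem_range.1 hk)]
  ring

theorem affineQKrawtchouk_eq_phiPartialSum {q : ℝ} (hq : q ≠ 0) (l : ℕ) (y : ℂ) (t : ℝ) (M : ℤ)
    {L : ℕ} (hL : l < L) :
    affineQKrawtchouk l y t M q =
      phiPartialSum ((q : ℂ) ^ (-(l : ℤ))) (t * q) ((q : ℂ) ^ (-M)) q y L := by
  have hq' : (q : ℂ) ≠ 0 := by exact_mod_cast hq
  rw [affineQKrawtchouk, phiPartialSum]
  simp only [qShiftedFactorial_zero_left, mul_one]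
  refine Finset.sum_subset (Finset.range_subset_range.2 (by omega)) fun k _ hk => ?_
  rw [qShiftedFactorial_eq_zero (i := l)]
  · simp
  · rw [zpow_neg, zpow_natCast]
    exact inv_mul_cancel₀ (pow_ne_zero _ hq')
  · by_contra h
    exact hk (Finset.mem_range.2 (by omega))

/-- The three-term recurrence. For `k = 0` the truncated index `k - 1` does not matter, since
`1 - q^0 = 0`. -/
theorem affineQKrawtchouk_recurrence {q t : ℝ} (hq0 : 0 < q) (hq1 : q < 1) (ht : t * q < 1)
    (ht0 : 0 < t) {k M : ℕ} (hk : k < M) (y : ℂ) :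
    (y - 1) * affineQKrawtchouk k y t M q =
      (1 - q ^ k / q ^ M) * (1 - t * q ^ (k + 1)) *
        (affineQKrawtchouk (k + 1) y t M q - affineQKrawtchouk k y t M q) +
      t * q ^ k / q ^ M * (1 - q ^ k) *
        (affineQKrawtchouk k y t M q - affineQKrawtchouk (k - 1) y t M q) := by
  have hq' : (q : ℂ) ≠ 0 := by exact_mod_cast hq0.ne'
  have hqk : (q : ℂ) ^ k ≠ 0 := pow_ne_zero _ hq'
  have hlt : ∀ i : ℕ, q ^ i ≤ 1 := fun i => pow_le_one₀ hq0.le hq1.le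
  have h := phiPartialSum_contiguous (r := (q : ℂ) ^ (-(k : ℤ))) (τ := (t : ℂ) * q)
    (μ := (q : ℂ) ^ (-(M : ℤ))) (q := (q : ℂ)) (y := y) (l := k) (zpow_ne_zero _ hq') hq'
    (qShiftedFactorial_eq_zero (i := k)
      (by rw [zpow_neg, zpow_natCast]; exact inv_mul_cancel₀ hqk) (by omega))
    (mul_ne_zero (mul_ne_zero
      (qShiftedFactorial_ne_zero fun i _ h => by
        have h' : t * q * q ^ i = 1 := by exact_mod_cast h
        nlinarith [hlt i, mul_pos ht0 hq0])
      (qShiftedFactorial_ne_zero fun i hi h => by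
        rw [zpow_neg, zpow_natCast, inv_mul_eq_one₀ (pow_ne_zero _ hq')] at h
        have h' : q ^ M = q ^ i := by exact_mod_cast h
        have := pow_lt_pow_right_of_lt_one₀ hq0 hq1 (show i < M by omega)
        linarith))
      (qShiftedFactorial_ne_zero fun i _ h => by
        have h' : q * q ^ i = 1 := by exact_mod_cast h
        nlinarith [hlt i]))
  rw [affineQKrawtchouk_eq_phiPartialSum hq0.ne' k y t M (show k < k + 2 by omega),
    affineQKrawtchouk_eq_phiPartialSum hq0.ne' (k + 1) y t M (show k + 1 < k + 2 by omega),
    affineQKrawtchouk_eq_phiPartialSum hq0.ne' (k - 1) y t M (show k - 1 < k + 2 by omega), h]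
  have e1 : (q : ℂ) ^ (-(k : ℤ)) / q = (q : ℂ) ^ (-((k + 1 : ℕ) : ℤ)) := by
    rw [Nat.cast_add, Nat.cast_one, neg_add', zpow_sub_one₀ hq', div_eq_mul_inv]
  rw [e1]
  simp only [zpow_neg, zpow_natCast]
  rcases Nat.eq_zero_or_pos k with rfl | hk0
  · simp
  · have e2 : ((q : ℂ) ^ k)⁻¹ * q = ((q : ℂ) ^ (k - 1))⁻¹ := by
      obtain ⟨j, rfl⟩ : ∃ j, k = j + 1 := ⟨k - 1, by omega⟩
      rw [add_tsub_cancel_right, pow_succ]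
      field_simp
    rw [e2]
    congr 1
    · congr 2
      · field_simp
      · field_simp
        ring
    · congr 1
      field_simp

/-! ### Orthonormal polynomials -/

/-- The factor `(-1)^k (tq)^{-k/2} √((q^M;q^{-1})_k (tq;q)_k / (q;q)_k)` by which the orthonormal
affine `q`-Krawtchouk polynomial of degree `k ≤ M` differs from the hypergeometric one. -/
noncomputable def krawtchoukNormalization (t q : ℝ) (M k : ℕ) : ℝ :=
  (-1) ^ k * (t * q) ^ (-(k : ℝ) / 2) *
    √(qShiftedFactorial (q ^ M) q⁻¹ k * qShiftedFactorial (t * q) q k / qShiftedFactorial q q k)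

/-- The diagonal coefficient `D q^M + P_k + Q_k` in the recurrence of the orthonormal affine
`q`-Krawtchouk polynomials in the variable `D q^M y`, where `P_k = D (q^k - q^M) (1 - t q^{k+1})` and
`Q_k = D t q^k (1 - q^k)`. The nodes of orthogonality are the points `D q^i` with `0 ≤ i ≤ M`. -/
noncomputable def krawtchoukDiag (D t q : ℝ) (M k : ℕ) : ℝ :=
  D * q ^ M + D * (q ^ k - q ^ M) * (1 - t * q ^ (k + 1)) + D * t * q ^ k * (1 - q ^ k)

/-- The off-diagonal coefficient `√P_{k-1} √Q_k` in the recurrence of the orthonormal affine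
`q`-Krawtchouk polynomials, with `P` and `Q` as for `krawtchoukDiag`. It vanishes for `k = 0`, where
the natural number `k - 1` is truncated, because `Q_0 = 0`. -/
noncomputable def krawtchoukOffDiag (D t q : ℝ) (M k : ℕ) : ℝ :=
  √(D * (q ^ (k - 1) - q ^ M) * (1 - t * q ^ k)) * √(D * t * q ^ k * (1 - q ^ k))

theorem orthonormalAffineQKrawtchouk_natCast {k M : ℕ} (hk : k ≤ M) (y : ℂ) (t q : ℝ) :
    orthonormalAffineQKrawtchouk k y t M q =
      krawtchoukNormalization t q M k * affineQKrawtchouk k y t M q := by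
  rw [orthonormalAffineQKrawtchouk, if_pos (by omega), krawtchoukNormalization]
  simp only [Int.toNat_natCast, Int.cast_natCast, zpow_natCast]

theorem orthonormalAffineQKrawtchouk_zero (y : ℂ) (t q : ℝ) (M : ℕ) :
    orthonormalAffineQKrawtchouk (0 : ℕ) y t M q = 1 := by
  rw [orthonormalAffineQKrawtchouk_natCast (Nat.zero_le M)]
  simp [krawtchoukNormalization, affineQKrawtchouk, qShiftedFactorial_zero_right]

theorem one_sub_mul_pow_succ_pos {t q : ℝ} (ht1 : t ≤ 1) (hq0 : 0 < q) (hq1 : q < 1) (k : ℕ) :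
    0 < 1 - t * q ^ (k + 1) := by
  have h1 : q ^ (k + 1) < 1 := pow_lt_one₀ hq0.le hq1 (by omega)
  have h2 : 0 < q ^ (k + 1) := pow_pos hq0 _
  nlinarith

theorem krawtchoukNormalization_succ {D t q : ℝ} {M k : ℕ} (hD : 0 < D) (ht0 : 0 < t)
    (ht1 : t ≤ 1) (hq0 : 0 < q) (hq1 : q < 1) (hk : k < M) :
    krawtchoukNormalization t q M (k + 1) = -(krawtchoukNormalization t q M k *
      √(D * (q ^ k - q ^ M) * (1 - t * q ^ (k + 1)) /
        (D * t * q ^ (k + 1) * (1 - q ^ (k + 1))))) := by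
  have hkM : q ^ M < q ^ k := pow_lt_pow_right_of_lt_one₀ hq0 hq1 hk
  have h1 : q ^ (k + 1) < 1 := pow_lt_one₀ hq0.le hq1 (by omega)
  have h2 := one_sub_mul_pow_succ_pos ht1 hq0 hq1 k
  have hqk : 0 < q ^ k := pow_pos hq0 _
  have htq : 0 < t * q := mul_pos ht0 hq0
  have hfac : D * (q ^ k - q ^ M) * (1 - t * q ^ (k + 1)) /
        (D * t * q ^ (k + 1) * (1 - q ^ (k + 1))) =
      (t * q)⁻¹ * ((1 - q ^ M * q⁻¹ ^ k) * (1 - t * q * q ^ k) / (1 - q * q ^ k)) := by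
    have h3 : 1 - q * q ^ k ≠ 0 := by rw [← pow_succ']; linarith
    rw [pow_succ', inv_pow]
    field_simp
  have hnn : 0 ≤ (1 - q ^ M * q⁻¹ ^ k) * (1 - t * q * q ^ k) / (1 - q * q ^ k) := by
    have h3 : q ^ M * q⁻¹ ^ k ≤ 1 := by
      rw [inv_pow, ← div_eq_mul_inv, div_le_one hqk]; exact hkM.le
    rw [← pow_succ', mul_assoc, ← pow_succ']
    exact div_nonneg (mul_nonneg (by linarith) h2.le) (by linarith)
  have hrp : (t * q) ^ (-((k + 1 : ℕ) : ℝ) / 2) = (t * q) ^ (-(k : ℝ) / 2) * √((t * q)⁻¹) := by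
    rw [Real.sqrt_eq_rpow, ← Real.rpow_neg_one, ← Real.rpow_mul htq.le, ← Real.rpow_add htq]
    congr 1
    push_cast
    ring
  rw [krawtchoukNormalization, krawtchoukNormalization, hrp, hfac,
    Real.sqrt_mul (inv_nonneg.2 htq.le), qShiftedFactorial_succ, qShiftedFactorial_succ,
    qShiftedFactorial_succ, mul_mul_mul_comm, mul_div_mul_comm, Real.sqrt_mul' _ hnn]
  ring

theorem krawtchoukOffDiag_mul_normalization {D t q : ℝ} {M k : ℕ} (hD : 0 < D) (ht0 : 0 < t)
    (ht1 : t ≤ 1) (hq0 : 0 < q) (hq1 : q < 1) (hk : k < M) :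
    krawtchoukOffDiag D t q M (k + 1) * krawtchoukNormalization t q M (k + 1) =
      -(D * (q ^ k - q ^ M) * (1 - t * q ^ (k + 1))) * krawtchoukNormalization t q M k ∧
    krawtchoukOffDiag D t q M (k + 1) * krawtchoukNormalization t q M k =
      -(D * t * q ^ (k + 1) * (1 - q ^ (k + 1))) * krawtchoukNormalization t q M (k + 1) := by
  have hkM : q ^ M < q ^ k := pow_lt_pow_right_of_lt_one₀ hq0 hq1 hk
  have h1 : q ^ (k + 1) < 1 := pow_lt_one₀ hq0.le hq1 (by omega)
  have h2 := one_sub_mul_pow_succ_pos ht1 hq0 hq1 k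
  have hP : 0 < D * (q ^ k - q ^ M) * (1 - t * q ^ (k + 1)) :=
    mul_pos (mul_pos hD (sub_pos.2 hkM)) h2
  have hQ : 0 < D * t * q ^ (k + 1) * (1 - q ^ (k + 1)) :=
    mul_pos (mul_pos (mul_pos hD ht0) (pow_pos hq0 _)) (sub_pos.2 h1)
  rw [krawtchoukNormalization_succ hD ht0 ht1 hq0 hq1 hk, krawtchoukOffDiag, add_tsub_cancel_right,
    Real.sqrt_div hP.le]
  generalize D * (q ^ k - q ^ M) * (1 - t * q ^ (k + 1)) = P at *
  generalize D * t * q ^ (k + 1) * (1 - q ^ (k + 1)) = Q at *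
  have hQ' : √Q ≠ 0 := (Real.sqrt_pos.2 hQ).ne'
  have e1 := Real.mul_self_sqrt hP.le
  have e2 := Real.mul_self_sqrt hQ.le
  constructor
  · field_simp
    linear_combination -(krawtchoukNormalization t q M k) * e1
  · nth_rw 2 [← e2]
    field_simp

theorem krawtchoukOffDiag_zero (D t q : ℝ) (M : ℕ) : krawtchoukOffDiag D t q M 0 = 0 := by
  simp [krawtchoukOffDiag]

theorem orthonormalAffineQKrawtchouk_recurrence {D t q : ℝ} {M k : ℕ} (hD : 0 < D) (ht0 : 0 < t)
    (ht1 : t ≤ 1) (hq0 : 0 < q) (hq1 : q < 1) (hk : k < M) (x : ℂ) {y : ℂ}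
    (hy : y * ((D * q ^ M : ℝ) : ℂ) = x) :
    (krawtchoukOffDiag D t q M (k + 1) : ℂ) *
        orthonormalAffineQKrawtchouk (k + 1 : ℕ) y t M q =
      (x - krawtchoukDiag D t q M k) * orthonormalAffineQKrawtchouk k y t M q -
        krawtchoukOffDiag D t q M k * orthonormalAffineQKrawtchouk (k - 1 : ℕ) y t M q := by
  have hq' : (q : ℂ) ≠ 0 := by exact_mod_cast hq0.ne'
  rw [orthonormalAffineQKrawtchouk_natCast (show k + 1 ≤ M by omega),
    orthonormalAffineQKrawtchouk_natCast hk.le,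
    orthonormalAffineQKrawtchouk_natCast (show k - 1 ≤ M by omega)]
  have hrec := affineQKrawtchouk_recurrence hq0 hq1 (by nlinarith) ht0 hk y
  have h1 := congrArg (fun r : ℝ => (r : ℂ))
    (krawtchoukOffDiag_mul_normalization hD ht0 ht1 hq0 hq1 hk).1
  have h2 : ((krawtchoukOffDiag D t q M k * krawtchoukNormalization t q M (k - 1) : ℝ) : ℂ) =
      ((-(D * t * q ^ k * (1 - q ^ k)) * krawtchoukNormalization t q M k : ℝ) : ℂ) := by
    congr 1
    rcases Nat.eq_zero_or_pos k with rfl | hk0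
    · simp [krawtchoukOffDiag_zero]
    · obtain ⟨j, rfl⟩ : ∃ j, k = j + 1 := ⟨k - 1, by omega⟩
      exact (krawtchoukOffDiag_mul_normalization hD ht0 ht1 hq0 hq1 (by omega)).2
  have hqM : (q : ℂ) ^ M ≠ 0 := pow_ne_zero _ hq'
  have hrec' : ((y - 1) * affineQKrawtchouk k y t M q) * q ^ M =
      (q ^ M - q ^ k) * (1 - t * q ^ (k + 1)) *
        (affineQKrawtchouk (k + 1) y t M q - affineQKrawtchouk k y t M q) +
      t * q ^ k * (1 - q ^ k) *
        (affineQKrawtchouk k y t M q - affineQKrawtchouk (k - 1) y t M q) := by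
    rw [hrec]
    field_simp
  rw [← hy, krawtchoukDiag]
  push_cast at h1 h2 ⊢
  linear_combination affineQKrawtchouk (k + 1) y t M q * h1 +
    affineQKrawtchouk (k - 1) y t M q * h2 - D * krawtchoukNormalization t q M k * hrec'

theorem orthonormalAffineQKrawtchouk_norm_le {D t q δ : ℝ} {M : ℕ} (hD : 0 < D) (ht0 : 0 < t)
    (ht1 : t ≤ 1) (hq0 : 0 < q) (hq1 : q < 1) {x y : ℂ}
    (hy : y * ((D * q ^ M : ℝ) : ℂ) = x) (hδ : 0 < δ)
    (hx : ∀ h ∈ Set.Icc 0 D, δ ≤ ‖x - (h : ℂ)‖) {l : ℕ} (hl : l < M) :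
    orthonormalAffineQKrawtchouk (l + 1 : ℕ) y t M q ≠ 0 ∧
      ∀ k ≤ l, δ * ‖orthonormalAffineQKrawtchouk k y t M q‖ ≤
        |krawtchoukOffDiag D t q M (l + 1)| *
          ‖orthonormalAffineQKrawtchouk (l + 1 : ℕ) y t M q‖ := by
  have hqk : ∀ k : ℕ, 0 < q ^ k := fun k => pow_pos hq0 _
  have hqk1 : ∀ k : ℕ, 0 ≤ 1 - q ^ k := fun k => sub_nonneg.2 (pow_le_one₀ hq0.le hq1.le)
  have htqk : ∀ k : ℕ, 0 ≤ 1 - t * q ^ k := fun k => by nlinarith [hqk k, hqk1 k]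
  have hqM : ∀ k ≤ M, 0 ≤ q ^ k - q ^ M := fun k hk =>
    sub_nonneg.2 (pow_le_pow_of_le_one hq0.le hq1.le hk)
  have hP : ∀ k ≤ M, 0 ≤ D * (q ^ k - q ^ M) * (1 - t * q ^ (k + 1)) := fun k hk =>
    mul_nonneg (mul_nonneg hD.le (hqM k hk)) (htqk _)
  have hQ : ∀ k, 0 ≤ D * t * q ^ k * (1 - q ^ k) := fun k =>
    mul_nonneg (mul_nonneg (mul_nonneg hD.le ht0.le) (hqk k).le) (hqk1 k)
  have hU : ∀ k ≤ M, 0 ≤ D * (q ^ k - q ^ M) * (t * q ^ (k + 1)) := fun k hk =>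
    mul_nonneg (mul_nonneg hD.le (hqM k hk)) (mul_nonneg ht0.le (hqk _).le)
  have hV : ∀ k, 0 ≤ D * (1 - q ^ k) * (1 - t * q ^ k) := fun k =>
    mul_nonneg (mul_nonneg hD.le (hqk1 k)) (htqk k)
  -- `D q^M + P_k + Q_k` and `D - D q^M - P_k - Q_k = U_k + V_k`, with `P_k Q_{k+1} = U_k V_{k+1}`, give
  -- the two bounds `0` and `D` of the Jacobi matrix.
  refine norm_le_of_jacobi_recurrence
    (p := fun k : ℕ => orthonormalAffineQKrawtchouk k y t M q)
    (a := krawtchoukOffDiag D t q M) (b := krawtchoukDiag D t q M)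
    (α := fun k => √(D * (q ^ k - q ^ M) * (1 - t * q ^ (k + 1))))
    (β := fun k => √(D * t * q ^ k * (1 - q ^ k)))
    (γ := fun k => √(D * (q ^ k - q ^ M) * (t * q ^ (k + 1))))
    (η := fun k => √(D * (1 - q ^ k) * (1 - t * q ^ k)))
    (krawtchoukOffDiag_zero D t q M) ?_
    (fun k hk => orthonormalAffineQKrawtchouk_recurrence hD ht0 ht1 hq0 hq1 hk x hy)
    (fun k _ => ?_) (fun k hk => ?_) (fun k hk => ?_) (fun k hk => ?_) hδ hx hl
  · simp only [orthonormalAffineQKrawtchouk_zero]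
    exact one_ne_zero
  · simp only [krawtchoukOffDiag, add_tsub_cancel_right]
  · simp only [krawtchoukOffDiag, add_tsub_cancel_right]
    rw [← Real.sqrt_mul (hP k hk.le), ← Real.sqrt_mul (hU k hk.le)]
    congr 1
    ring
  · rw [Real.sq_sqrt (hP k hk), Real.sq_sqrt (hQ k), krawtchoukDiag]
    have := mul_pos hD (hqk M)
    linarith
  · rw [Real.sq_sqrt (hU k hk), Real.sq_sqrt (hV k), krawtchoukDiag]
    apply le_of_eq
    ring

/-! ### The Joukowski map -/

theorem joukowskiRho_add_inv (z : ℂ) (hz : z ∉ Complex.ofReal '' Set.Icc (-1) 1) :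
    joukowskiRho z + (joukowskiRho z)⁻¹ = 2 * z := by
  obtain ⟨h1, h2⟩ := joukowskiRho_spec z hz
  have h0 : joukowskiRho z ≠ 0 := norm_pos_iff.1 (one_pos.trans h1)
  field_simp
  linear_combination h2

/-- A point at distance `ε` from `[-1, 1]` lies on or outside the ellipse that `ρ` maps to the circle of radius
`1 + ε`. -/
theorem one_add_le_norm_joukowskiRho {z : ℂ} {ε : ℝ} (hε : 0 < ε)
    (hz : ∀ s ∈ Set.Icc (-1 : ℝ) 1, ε ≤ ‖z - (s : ℂ)‖) : 1 + ε ≤ ‖joukowskiRho z‖ := by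
  have hz' : z ∉ Complex.ofReal '' Set.Icc (-1) 1 := by
    rintro ⟨s, hs, rfl⟩
    have := hz s hs
    rw [sub_self, norm_zero] at this
    linarith
  have h1 := (joukowskiRho_spec z hz').1
  have h2 := joukowskiRho_add_inv z hz'
  set ρ := joukowskiRho z
  set R := ‖ρ‖ with hR
  have hR0 : 0 < R := one_pos.trans h1
  have hRc : (R : ℂ) ≠ 0 := by exact_mod_cast hR0.ne'
  -- `u = ρ / |ρ|` lies on the unit circle, and the real number `Re u` is close to `z`.
  obtain ⟨u, hu⟩ : ∃ u : ℂ, u = ρ / R := ⟨_, rfl⟩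
  have hun : ‖u‖ = 1 := by
    rw [hu, norm_div, Complex.norm_real, Real.norm_eq_abs, abs_of_pos hR0, ← hR,
      div_self hR0.ne']
  have hρu : ρ = R * u := by rw [hu]; field_simp
  have huinv : u⁻¹ = (starRingEnd ℂ) u := by
    rw [Complex.inv_def, Complex.normSq_eq_norm_sq, hun]; simp
  have hre : (u.re : ℂ) = (u + u⁻¹) / 2 := by
    rw [huinv, Complex.add_conj]; push_cast; ring
  have hs : u.re ∈ Set.Icc (-1 : ℝ) 1 := by
    have := Complex.abs_re_le_norm u
    rw [hun] at this
    exact abs_le.1 this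
  have hdiff : z - u.re = ((R - 1 : ℝ) * u - (1 - R⁻¹ : ℝ) * u⁻¹) / 2 := by
    rw [hre]
    rw [hρu, mul_inv] at h2
    push_cast
    linear_combination (-1 / 2 : ℂ) * h2
  have hinv : R⁻¹ ≤ 1 := inv_le_one_of_one_le₀ h1.le
  have hinv2 : 2 - R ≤ R⁻¹ := by
    have : R * R⁻¹ = 1 := mul_inv_cancel₀ hR0.ne'
    nlinarith [sq_nonneg (R - 1), inv_pos.2 hR0]
  have hle : ‖z - u.re‖ ≤ ((R - 1) + (1 - R⁻¹)) / 2 := by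
    rw [hdiff, norm_div]
    simp only [Complex.norm_ofNat]
    gcongr
    refine (norm_sub_le _ _).trans (le_of_eq ?_)
    rw [norm_mul, norm_mul, norm_inv, hun, Complex.norm_real, Complex.norm_real, Real.norm_eq_abs,
      Real.norm_eq_abs, abs_of_pos (by linarith), abs_of_nonneg (by linarith)]
    ring
  have := hz _ hs
  linarith

theorem norm_joukowskiRho_le {z : ℂ} (hz : z ∉ Complex.ofReal '' Set.Icc (-1) 1) :
    ‖joukowskiRho z‖ ≤ 2 * ‖z‖ + 1 := by
  have h1 := (joukowskiRho_spec z hz).1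
  have h2 := joukowskiRho_add_inv z hz
  have h3 : joukowskiRho z = 2 * z - (joukowskiRho z)⁻¹ := by linear_combination h2
  rw [h3]
  refine (norm_sub_le _ _).trans (add_le_add (by simp) ?_)
  rw [norm_inv]
  exact inv_le_one_of_one_le₀ h1.le

/-! ### Limits of the recurrence coefficients -/

/-- Limits of the recurrence coefficients, and the inclusion `[B - 2A, B + 2A] ⊆ [0, 1]`: `A²` is
`P Q` with `P + Q = B - c^N`, and also `U V` with `U + V = 1 - B`, so that both bounds are
instances of `2√(PQ) ≤ P + Q`. -/
theorem limit_interval_subset {c t A B : ℝ} {N : ℕ} (hc0 : 0 < c) (hc1 : c < 1) (ht0 : 0 < t)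
    (ht1 : t ≤ 1) (hN : 2 ≤ N)
    (hA : A = c * √(t * (1 - t * c) * (1 - c) * (1 - c ^ (N - 1))))
    (hB : B = c + t * c - 2 * t * c ^ 2 + t * c ^ (1 + N)) :
    0 < A ∧ 0 ≤ B - 2 * A ∧ B + 2 * A ≤ 1 ∧
      A = √((c - c ^ N) * (1 - t * c)) * √(t * c * (1 - c)) ∧
      B = c ^ N + (c - c ^ N) * (1 - t * c) + t * c * (1 - c) := by
  have h1 : 0 < 1 - t * c := by nlinarith
  have h2 : 0 < 1 - c := by linarith
  have h3 : 0 < 1 - c ^ (N - 1) := sub_pos.2 (pow_lt_one₀ hc0.le hc1 (by omega))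
  have hcN : c ^ N = c * c ^ (N - 1) := by
    rw [← pow_succ']
    congr 1
    omega
  have hB' : B = c ^ N + (c - c ^ N) * (1 - t * c) + t * c * (1 - c) := by
    rw [hB, pow_add]; ring
  have h4 : 0 < c - c ^ N := by rw [hcN]; nlinarith
  have hcN0 : 0 < c ^ N := pow_pos hc0 _
  have hP : 0 < (c - c ^ N) * (1 - t * c) := mul_pos h4 h1
  have hQ : 0 < t * c * (1 - c) := by positivity
  have hApos : 0 < A := by rw [hA]; positivity
  have hAsq : A ^ 2 = (c - c ^ N) * (1 - t * c) * (t * c * (1 - c)) := by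
    rw [hA, mul_pow, Real.sq_sqrt (by positivity), hcN]; ring
  refine ⟨hApos, ?_, ?_, ?_, hB'⟩
  · have : 2 * A ≤ (c - c ^ N) * (1 - t * c) + t * c * (1 - c) := by
      refine abs_le_of_sq_le_sq' ?_ (by positivity) |>.2
      nlinarith [sq_nonneg ((c - c ^ N) * (1 - t * c) - t * c * (1 - c))]
    linarith
  · have : 2 * A ≤ (c - c ^ N) * (t * c) + (1 - t * c) * (1 - c) := by
      refine abs_le_of_sq_le_sq' ?_ (by positivity) |>.2
      nlinarith [sq_nonneg ((c - c ^ N) * (t * c) - (1 - t * c) * (1 - c))]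
    have e : 1 - B = (c - c ^ N) * (t * c) + (1 - t * c) * (1 - c) := by rw [hB']; ring
    linarith
  · rw [← Real.sqrt_mul hP.le, ← hAsq, Real.sqrt_sq hApos.le]

theorem tendsto_rpow_one_div_natCast {c : ℝ} (hc0 : 0 < c) :
    Tendsto (fun n : ℕ => c ^ (1 / (n : ℝ))) atTop (𝓝 1) := by
  have h := (Real.continuousAt_const_rpow (b := 0) hc0.ne').tendsto.comp
    tendsto_one_div_atTop_nhds_zero_nat
  rwa [Real.rpow_zero] at h

theorem rpow_one_div_natCast_lt_one {c : ℝ} (hc0 : 0 < c) (hc1 : c < 1) {n : ℕ} (hn : 1 ≤ n) :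
    c ^ (1 / (n : ℝ)) < 1 :=
  Real.rpow_lt_one hc0.le hc1 (one_div_pos.2 (by exact_mod_cast hn))

theorem tendsto_rpow_one_div_zpow {c : ℝ} (hc0 : 0 < c) (j : ℤ) :
    Tendsto (fun n : ℕ => (c ^ (1 / (n : ℝ))) ^ j) atTop (𝓝 1) := by
  have h := (tendsto_rpow_one_div_natCast hc0).zpow₀ j (Or.inl one_ne_zero)
  rwa [one_zpow] at h

theorem rpow_one_div_natCast_pow {c : ℝ} (hc0 : 0 < c) {n : ℕ} (hn : 1 ≤ n) :
    (c ^ (1 / (n : ℝ))) ^ n = c := by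
  rw [one_div]
  exact Real.rpow_inv_natCast_pow hc0.le (by omega)

/-- The powers of `q = c^{1/n}` with exponent `nr + j` converge to `c^r`. -/
theorem tendsto_rpow_one_div_pow_toNat {c : ℝ} (hc0 : 0 < c) {r : ℕ} (hr : 1 ≤ r) (j : ℤ) :
    Tendsto (fun n : ℕ => (c ^ (1 / (n : ℝ))) ^ ((n : ℤ) * r + j).toNat) atTop (𝓝 (c ^ r)) := by
  have h := (tendsto_rpow_one_div_zpow hc0 j).const_mul (c ^ r)
  rw [mul_one] at h
  refine h.congr' ?_
  filter_upwards [eventually_ge_atTop (1 + j.natAbs)] with n hn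
  have hq : c ^ (1 / (n : ℝ)) ≠ 0 := (Real.rpow_pos_of_pos hc0 _).ne'
  have hnr : (n : ℤ) ≤ n * r := le_mul_of_one_le_right (by omega) (by exact_mod_cast hr)
  rw [← zpow_natCast _ (Int.toNat _), Int.toNat_of_nonneg (by omega), zpow_add₀ hq, zpow_mul,
    zpow_natCast, zpow_natCast, rpow_one_div_natCast_pow hc0 (by omega)]

theorem tendsto_krawtchouk_coefficients {c t : ℝ} (hc0 : 0 < c) {N : ℕ} (hN : 1 ≤ N) (a j : ℤ) :
    Tendsto (fun n : ℕ => krawtchoukOffDiag ((c ^ (1 / (n : ℝ))) ^ (-a)) t (c ^ (1 / (n : ℝ)))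
        ((n : ℤ) * N + a).toNat ((n : ℤ) + j).toNat) atTop
      (𝓝 (√((c - c ^ N) * (1 - t * c)) * √(t * c * (1 - c)))) ∧
    Tendsto (fun n : ℕ => krawtchoukDiag ((c ^ (1 / (n : ℝ))) ^ (-a)) t (c ^ (1 / (n : ℝ)))
        ((n : ℤ) * N + a).toNat ((n : ℤ) + j).toNat) atTop
      (𝓝 (c ^ N + (c - c ^ N) * (1 - t * c) + t * c * (1 - c))) := by
  have hD := tendsto_rpow_one_div_zpow hc0 (-a)
  have hM := tendsto_rpow_one_div_pow_toNat hc0 hN a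
  have hk : ∀ i : ℤ, Tendsto (fun n : ℕ => (c ^ (1 / (n : ℝ))) ^ ((n : ℤ) + i).toNat) atTop
      (𝓝 c) := fun i => by
    have h := tendsto_rpow_one_div_pow_toNat hc0 le_rfl i
    simpa using h
  have hk1 : Tendsto (fun n : ℕ => (c ^ (1 / (n : ℝ))) ^ (((n : ℤ) + j).toNat - 1)) atTop
      (𝓝 c) := by
    refine (hk (j - 1)).congr' ?_
    filter_upwards with n
    congr 1
    omega
  have hk2 : Tendsto (fun n : ℕ => (c ^ (1 / (n : ℝ))) ^ (((n : ℤ) + j).toNat + 1)) atTop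
      (𝓝 c) := by
    refine (hk (j + 1)).congr' ?_
    filter_upwards [eventually_ge_atTop j.natAbs] with n hn
    congr 1
    omega
  constructor
  · have h1 := ((hD.mul (hk1.sub hM)).mul (((hk j).const_mul t).const_sub 1)).sqrt
    have h2 := (((hD.mul_const t).mul (hk j)).mul ((hk j).const_sub 1)).sqrt
    simpa only [krawtchoukOffDiag, one_mul] using h1.mul h2
  · have h1 := (hD.mul ((hk j).sub hM)).mul ((hk2.const_mul t).const_sub 1)
    have h2 := ((hD.mul_const t).mul (hk j)).mul ((hk j).const_sub 1)
    simpa only [krawtchoukDiag, one_mul] using ((hD.mul hM).add h1).add h2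

/-! ### Uniform asymptotics on compact sets -/

theorem exists_pos_le_norm_sub_ofReal {K : Set ℂ} (hK : IsCompact K)
    (hK' : K ⊆ (Complex.ofReal '' Set.Icc 0 1)ᶜ) :
    ∃ δ > 0, ∀ x ∈ K, ∀ s ∈ Set.Icc (0 : ℝ) 1, δ ≤ ‖x - (s : ℂ)‖ := by
  obtain ⟨δ, hδ, h⟩ := (hK.prod (isCompact_Icc (a := (0 : ℝ)) (b := 1))).exists_forall_le'
    (f := fun y : ℂ × ℝ => ‖y.1 - (y.2 : ℂ)‖) (a := 0) (by fun_prop) (by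
      rintro ⟨x, s⟩ ⟨hx, hs⟩
      refine norm_pos_iff.2 (sub_ne_zero.2 ?_)
      intro h
      exact hK' hx ⟨s, hs, h.symm⟩)
  exact ⟨δ, hδ, fun x hx s hs => h (x, s) ⟨hx, hs⟩⟩

/-- The argument of `K̂_l` in `scaledQKrawtchouk` is `x / (D q^M)` with `q = c^{1/n}`,
`M = nN + a` and `D = q^{-a}`. -/
theorem mul_zpow_neg_mul_eq {q : ℝ} (hq : q ≠ 0) {K a : ℤ} (hM : 0 ≤ K + a) (x : ℂ) :
    x * (q : ℂ) ^ (-K) * ((q ^ (-a) * q ^ (K + a).toNat : ℝ) : ℂ) = x := by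
  have hq' : (q : ℂ) ≠ 0 := by exact_mod_cast hq
  have h : q ^ (-a) * q ^ (K + a).toNat = q ^ K := by
    rw [← zpow_natCast q, Int.toNat_of_nonneg hM, ← zpow_add₀ hq]
    congr 1
    ring
  rw [h]
  push_cast
  rw [mul_assoc, ← zpow_add₀ hq', neg_add_cancel, zpow_zero, mul_one]

/-- For large `n`, the degrees `n + i` and `n + j` lie in the range between `0` and the maximal degree
`nN + a`, because `N ≥ 2`. -/
theorem eventually_index_bounds {N : ℕ} (hN : 2 ≤ N) (a i j : ℤ) :
    ∀ᶠ n : ℕ in atTop, 1 ≤ n ∧ 0 < (n : ℤ) + i ∧ (n : ℤ) + j < n * N + a := by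
  filter_upwards [eventually_ge_atTop (1 + i.natAbs + j.natAbs + a.natAbs)] with n hn
  have h : (n : ℤ) * 2 ≤ n * N := mul_le_mul_of_nonneg_left (by exact_mod_cast hN) (by omega)
  omega

theorem scaledQKrawtchouk_eq (c t : ℝ) (N : ℕ) (a : ℤ) {n k : ℕ} {l : ℤ} (x : ℂ) (hk : (k : ℤ) = l)
    (hM : 0 ≤ (n : ℤ) * N + a) :
    scaledQKrawtchouk c t N a n l x = orthonormalAffineQKrawtchouk k
      (x * ((c ^ (1 / (n : ℝ)) : ℝ) : ℂ) ^ (-((n : ℤ) * (N : ℤ)))) t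
      (((n : ℤ) * N + a).toNat : ℕ) (c ^ (1 / (n : ℝ))) := by
  rw [scaledQKrawtchouk, hk, Int.toNat_of_nonneg hM]

/-- The off-diagonal recurrence coefficient with index `n + j` of the polynomials
`scaledQKrawtchouk c t N a n`. -/
noncomputable def scaledOffDiag (c t : ℝ) (N : ℕ) (a j : ℤ) (n : ℕ) : ℝ :=
  krawtchoukOffDiag ((c ^ (1 / (n : ℝ))) ^ (-a)) t (c ^ (1 / (n : ℝ))) ((n : ℤ) * N + a).toNat
    ((n : ℤ) + j).toNat

/-- The diagonal recurrence coefficient with index `n + j` of the polynomials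
`scaledQKrawtchouk c t N a n`. -/
noncomputable def scaledDiag (c t : ℝ) (N : ℕ) (a j : ℤ) (n : ℕ) : ℝ :=
  krawtchoukDiag ((c ^ (1 / (n : ℝ))) ^ (-a)) t (c ^ (1 / (n : ℝ))) ((n : ℤ) * N + a).toNat
    ((n : ℤ) + j).toNat

theorem eventually_scaledQKrawtchouk_recurrence {c t : ℝ} (hc0 : 0 < c) (hc1 : c < 1)
    (ht0 : 0 < t) (ht1 : t ≤ 1) {N : ℕ} (hN : 2 ≤ N) (a j : ℤ) :
    ∀ᶠ n : ℕ in atTop, ∀ x : ℂ,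
      (scaledOffDiag c t N a (j + 1) n : ℂ) * scaledQKrawtchouk c t N a n (n + (j + 1)) x =
        (x - scaledDiag c t N a j n) * scaledQKrawtchouk c t N a n (n + j) x -
          scaledOffDiag c t N a j n * scaledQKrawtchouk c t N a n (n + (j - 1)) x := by
  filter_upwards [eventually_index_bounds hN a j j] with n ⟨h1, h2, h3⟩ x
  have hq0 : 0 < c ^ (1 / (n : ℝ)) := Real.rpow_pos_of_pos hc0 _
  obtain ⟨k, hk⟩ : ∃ k : ℕ, (k : ℤ) = n + j := ⟨_, Int.toNat_of_nonneg h2.le⟩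
  have e1 : ((n : ℤ) + (j + 1)).toNat = k + 1 := by omega
  have e2 : ((n : ℤ) + j).toNat = k := by omega
  rw [scaledQKrawtchouk_eq c t N a (k := k + 1) x (by omega) (by omega),
    scaledQKrawtchouk_eq c t N a (k := k) x hk (by omega),
    scaledQKrawtchouk_eq c t N a (k := k - 1) x (by omega) (by omega),
    scaledOffDiag, scaledOffDiag, scaledDiag, e1, e2]
  exact orthonormalAffineQKrawtchouk_recurrence (zpow_pos hq0 _) ht0 ht1 hq0
    (rpow_one_div_natCast_lt_one hc0 hc1 h1) (by omega) x
    (mul_zpow_neg_mul_eq hq0.ne' (by omega) x)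

/-- On a set at positive distance from `[0, 1]` the denominators do not vanish for large `n`, and the
polynomial of degree `n + j` dominates those of lower degree, uniformly in `n` and `x`. -/
theorem eventually_norm_scaledQKrawtchouk_le {c t A δ : ℝ} (hc0 : 0 < c) (hc1 : c < 1)
    (ht0 : 0 < t) (ht1 : t ≤ 1) {N : ℕ} (hN : 2 ≤ N) {a i j : ℤ} (hij : i < j) {K : Set ℂ}
    (hδ : 0 < δ) (hdist : ∀ x ∈ K, ∀ s ∈ Set.Icc (0 : ℝ) 1, δ ≤ ‖x - (s : ℂ)‖)
    (hA : Tendsto (scaledOffDiag c t N a j) atTop (𝓝 A)) :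
    ∀ᶠ n : ℕ in atTop, ∀ x ∈ K, scaledQKrawtchouk c t N a n (n + j) x ≠ 0 ∧
      ‖scaledQKrawtchouk c t N a n (n + i) x‖ ≤
        (|A| + 1) / (δ / 2) * ‖scaledQKrawtchouk c t N a n (n + j) x‖ := by
  filter_upwards [eventually_index_bounds hN a i j,
    (tendsto_rpow_one_div_zpow hc0 (-a)).eventually_lt_const
      (show (1 : ℝ) < 1 + δ / 2 by linarith),
    hA.abs.eventually_lt_const (lt_add_one |A|)] with n ⟨h1, h2, h3⟩ h4 h5 x hx
  have hq0 : 0 < c ^ (1 / (n : ℝ)) := Real.rpow_pos_of_pos hc0 _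
  obtain ⟨k, hk⟩ : ∃ k : ℕ, (k : ℤ) = n + i := ⟨_, Int.toNat_of_nonneg h2.le⟩
  obtain ⟨l, hl⟩ : ∃ l : ℕ, ((l + 1 : ℕ) : ℤ) = n + j := ⟨((n : ℤ) + j - 1).toNat, by omega⟩
  have e1 : ((n : ℤ) + j).toNat = l + 1 := by omega
  -- Points of `[0, D]` are within `δ / 2` of `[0, 1]`, because `D` is close to `1`.
  have hdist' : ∀ h ∈ Set.Icc 0 ((c ^ (1 / (n : ℝ))) ^ (-a)), δ / 2 ≤ ‖x - (h : ℂ)‖ := by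
    rintro h ⟨hh0, hh1⟩
    have e2 := hdist x hx (min h 1) ⟨le_min hh0 zero_le_one, min_le_right _ _⟩
    have e3 : ‖((h : ℂ) - (min h 1 : ℝ))‖ ≤ δ / 2 := by
      rw [← Complex.ofReal_sub, Complex.norm_real, Real.norm_eq_abs, abs_le]
      rcases min_cases h 1 with ⟨e, _⟩ | ⟨e, _⟩ <;> rw [e] <;> constructor <;> linarith
    have e4 := norm_add_le (x - (h : ℂ)) ((h : ℂ) - (min h 1 : ℝ))
    rw [sub_add_sub_cancel] at e4
    linarith
  obtain ⟨r1, r2⟩ := orthonormalAffineQKrawtchouk_norm_le (zpow_pos hq0 (-a)) ht0 ht1 hq0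
    (rpow_one_div_natCast_lt_one hc0 hc1 h1)
    (mul_zpow_neg_mul_eq hq0.ne' (K := (n : ℤ) * N) (a := a) (by omega) x)
    (half_pos hδ) hdist' (l := l) (by omega)
  rw [scaledQKrawtchouk_eq c t N a (k := k) x hk (by omega),
    scaledQKrawtchouk_eq c t N a (k := l + 1) x hl (by omega)]
  refine ⟨r1, ?_⟩
  rw [scaledOffDiag, e1] at h5
  rw [div_mul_eq_mul_div, le_div_iff₀' (half_pos hδ)]
  exact (r2 k (by omega)).trans (mul_le_mul_of_nonneg_right h5.le (norm_nonneg _))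

theorem exists_bounds_norm_joukowskiRho {A B δ : ℝ} {K : Set ℂ} (hA : 0 < A) (hlow : 0 ≤ B - 2 * A)
    (hupp : B + 2 * A ≤ 1) (hK : IsCompact K) (hδ : 0 < δ)
    (hdist : ∀ x ∈ K, ∀ s ∈ Set.Icc (0 : ℝ) 1, δ ≤ ‖x - (s : ℂ)‖) :
    ∃ R > 1, ∃ R', ∀ x ∈ K, R ≤ ‖joukowskiRho ((x - (B : ℂ)) / (2 * (A : ℂ)))‖ ∧
      ‖joukowskiRho ((x - (B : ℂ)) / (2 * (A : ℂ)))‖ ≤ R' := by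
  obtain ⟨C, hC⟩ := hK.isBounded.exists_norm_le
  have hA0 : (A : ℂ) ≠ 0 := by exact_mod_cast hA.ne'
  have hε : 0 < δ / (2 * A) := by positivity
  have h2A : ‖(2 * (A : ℂ))‖ = 2 * A := by
    rw [norm_mul, Complex.norm_real, Real.norm_eq_abs, abs_of_pos hA, Complex.norm_ofNat]
  have hz : ∀ x ∈ K, ∀ s ∈ Set.Icc (-1 : ℝ) 1,
      δ / (2 * A) ≤ ‖(x - (B : ℂ)) / (2 * (A : ℂ)) - s‖ := by
    intro x hx s hs
    have e : (x - (B : ℂ)) / (2 * (A : ℂ)) - s = (x - ((B + 2 * A * s : ℝ) : ℂ)) / (2 * A) := by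
      push_cast
      field_simp
      ring
    rw [e, norm_div, h2A]
    exact div_le_div_of_nonneg_right
      (hdist x hx _ ⟨by nlinarith [hs.1], by nlinarith [hs.2]⟩) (by positivity)
  refine ⟨1 + δ / (2 * A), by linarith, 2 * ((C + |B|) / (2 * A)) + 1, fun x hx =>
    ⟨one_add_le_norm_joukowskiRho hε (hz x hx), ?_⟩⟩
  refine (norm_joukowskiRho_le ?_).trans ?_
  · rintro ⟨s, hs, h⟩
    have := hz x hx s hs
    rw [← h, sub_self, norm_zero] at this
    linarith
  · rw [norm_div, h2A]
    have e := norm_sub_le x (B : ℂ)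
    rw [Complex.norm_real, Real.norm_eq_abs] at e
    have := hC x hx
    gcongr
    linarith

theorem tendstoUniformlyOn_of_tendsto_div_zpow {f : ℕ → ℂ → ℂ} {ρ : ℂ → ℂ} {K : Set ℂ} {R R' : ℝ}
    {m : ℤ} (hR : 1 < R) (hρ : ∀ x ∈ K, R ≤ ‖ρ x‖ ∧ ‖ρ x‖ ≤ R')
    (hf : Tendsto (fun ω : ℕ × ℂ => f ω.1 ω.2 / ρ ω.2 ^ m) (atTop ×ˢ 𝓟 K) (𝓝 1)) :
    TendstoUniformlyOn f (fun x => ρ x ^ m) atTop K := by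
  rw [Metric.tendstoUniformlyOn_iff]
  have hbd : (atTop ×ˢ 𝓟 K : Filter (ℕ × ℂ)).IsBoundedUnder (· ≤ ·)
      (norm ∘ fun ω => ρ ω.2 ^ m) := by
    refine ⟨R' ^ m.natAbs, ?_⟩
    rw [eventually_map, eventually_prod_principal_iff]
    refine Eventually.of_forall fun n x hx => ?_
    have h1 : 1 ≤ ‖ρ x‖ := hR.le.trans (hρ x hx).1
    rw [Function.comp_apply, norm_zpow]
    calc ‖ρ x‖ ^ m ≤ ‖ρ x‖ ^ (m.natAbs : ℤ) := zpow_le_zpow_right₀ h1 (by omega)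
      _ = ‖ρ x‖ ^ m.natAbs := zpow_natCast _ _
      _ ≤ R' ^ m.natAbs := pow_le_pow_left₀ (norm_nonneg _) (hρ x hx).2 _
  have h0 := hf.sub_const 1
  rw [sub_self] at h0
  intro e he
  have h2 := NormedAddGroup.tendsto_nhds_zero.1 (h0.zero_mul_isBoundedUnder_le hbd) e he
  rw [eventually_prod_principal_iff] at h2
  filter_upwards [h2] with n hn x hx
  have hρ0 : ρ x ≠ 0 := norm_pos_iff.1 (one_pos.trans (hR.trans_le (hρ x hx).1))
  have h3 := hn x hx
  rwa [sub_mul, div_mul_cancel₀ _ (zpow_ne_zero _ hρ0), one_mul, ← dist_eq_norm, dist_comm] at h3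

theorem proposition7p1 (c t : ℝ) (hc0 : 0 < c) (hc1 : c < 1) (ht0 : 0 < t) (ht1 : t ≤ 1)
    (a m : ℤ) (N : ℕ) (hN : 2 ≤ N) (A B : ℝ)
    (hA : A = c * √(t * (1 - t * c) * (1 - c) * (1 - c ^ (N - 1))))
    (hB : B = c + t * c - 2 * t * c ^ 2 + t * c ^ (1 + N)) :
    0 < A ∧
    (∀ x : ℂ, x ∉ Complex.ofReal '' Set.Icc 0 1 →
      (x - (B : ℂ)) / (2 * (A : ℂ)) ∉ Complex.ofReal '' Set.Icc (-1) 1) ∧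
    ∀ K : Set ℂ, IsCompact K → K ⊆ (Complex.ofReal '' Set.Icc 0 1)ᶜ →
      (∀ᶠ n : ℕ in atTop, ∀ x ∈ K, scaledQKrawtchouk c t N a n (n : ℤ) x ≠ 0) ∧
      TendstoUniformlyOn
        (fun (n : ℕ) (x : ℂ) =>
          scaledQKrawtchouk c t N a n ((n : ℤ) + m) x / scaledQKrawtchouk c t N a n (n : ℤ) x)
        (fun x : ℂ => joukowskiRho ((x - (B : ℂ)) / (2 * (A : ℂ))) ^ m)
        atTop K := by
  obtain ⟨hApos, hlow, hupp, hAlim, hBlim⟩ := limit_interval_subset hc0 hc1 ht0 ht1 hN hA hB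
  have hA0 : (A : ℂ) ≠ 0 := by exact_mod_cast hApos.ne'
  have hmem : ∀ s ∈ Set.Icc (-1 : ℝ) 1, B + 2 * A * s ∈ Set.Icc (0 : ℝ) 1 := fun s hs =>
    ⟨by nlinarith [hs.1], by nlinarith [hs.2]⟩
  have hout : ∀ x : ℂ, x ∉ Complex.ofReal '' Set.Icc 0 1 →
      (x - (B : ℂ)) / (2 * (A : ℂ)) ∉ Complex.ofReal '' Set.Icc (-1) 1 := by
    rintro x hx ⟨s, hs, h⟩
    refine hx ⟨B + 2 * A * s, hmem s hs, ?_⟩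
    rw [eq_div_iff (by simpa using hA0)] at h
    push_cast
    linear_combination h
  refine ⟨hApos, hout, fun K hK hK' => ?_⟩
  obtain ⟨δ, hδ, hdist⟩ := exists_pos_le_norm_sub_ofReal hK hK'
  obtain ⟨C', hC'⟩ := hK.isBounded.exists_norm_le
  have hofflim : ∀ j, Tendsto (scaledOffDiag c t N a j) atTop (𝓝 A) := fun j => by
    rw [hAlim]; exact (tendsto_krawtchouk_coefficients hc0 (by omega) a j).1
  have hdialim : ∀ j, Tendsto (scaledDiag c t N a j) atTop (𝓝 B) := fun j => by
    rw [hBlim]; exact (tendsto_krawtchouk_coefficients hc0 (by omega) a j).2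
  have hest := fun (i j : ℤ) (hij : i < j) =>
    eventually_norm_scaledQKrawtchouk_le hc0 hc1 ht0 ht1 hN hij hδ hdist (hofflim j)
  obtain ⟨R, hR, R', hρ⟩ := exists_bounds_norm_joukowskiRho hApos hlow hupp hK hδ hdist
  refine ⟨?_, ?_⟩
  · filter_upwards [hest (-1) 0 (by omega)] with n hn x hx
    have := (hn x hx).1
    rwa [add_zero] at this
  have hFK : ∀ᶠ ω in (atTop ×ˢ 𝓟 K : Filter (ℕ × ℂ)), ω.2 ∈ K :=
    Eventually.prod_inr (eventually_principal.2 fun _ h => h) _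
  have hne : ∀ j : ℤ, ∀ᶠ ω in (atTop ×ˢ 𝓟 K : Filter (ℕ × ℂ)),
      scaledQKrawtchouk c t N a ω.1 (ω.1 + j) ω.2 ≠ 0 := fun j => by
    filter_upwards [(hest (j - 1) j (by omega)).prod_inl _, hFK] with ω h1 h2 using (h1 ω.2 h2).1
  refine tendstoUniformlyOn_of_tendsto_div_zpow hR hρ ?_
  have hrec : ∀ j : ℤ, ∀ᶠ ω in (atTop ×ˢ 𝓟 K : Filter (ℕ × ℂ)),
      (scaledOffDiag c t N a (j + 1) ω.1 : ℂ) *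
          scaledQKrawtchouk c t N a ω.1 (ω.1 + (j + 1)) ω.2 =
        (ω.2 - scaledDiag c t N a j ω.1) * scaledQKrawtchouk c t N a ω.1 (ω.1 + j) ω.2 -
          scaledOffDiag c t N a j ω.1 * scaledQKrawtchouk c t N a ω.1 (ω.1 + (j - 1)) ω.2 :=
    fun j => by
      filter_upwards [(eventually_scaledQKrawtchouk_recurrence hc0 hc1 ht0 ht1 hN a j).prod_inl _]
        with ω h using h ω.2
  have hbd : ∀ i j : ℤ, i < j → ∀ᶠ ω in (atTop ×ˢ 𝓟 K : Filter (ℕ × ℂ)),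
      ‖scaledQKrawtchouk c t N a ω.1 (ω.1 + i) ω.2‖ ≤
        (|A| + 1) / (δ / 2) * ‖scaledQKrawtchouk c t N a ω.1 (ω.1 + j) ω.2‖ := fun i j hij => by
    filter_upwards [(hest i j hij).prod_inl _, hFK] with ω h1 h2 using (h1 ω.2 h2).2
  have hρX : ∀ᶠ ω in (atTop ×ˢ 𝓟 K : Filter (ℕ × ℂ)),
      (A : ℂ) * (joukowskiRho ((ω.2 - (B : ℂ)) / (2 * (A : ℂ))) +
        (joukowskiRho ((ω.2 - (B : ℂ)) / (2 * (A : ℂ))))⁻¹) = ω.2 - B := by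
    filter_upwards [hFK] with ω h
    rw [joukowskiRho_add_inv _ (hout _ (hK' h))]
    field_simp
  have hstep := tendsto_ratio_div_of_recurrence
    (p := fun j ω => scaledQKrawtchouk c t N a ω.1 (ω.1 + j) ω.2) (X := fun ω : ℕ × ℂ => ω.2)
    (ρ := fun ω : ℕ × ℂ => joukowskiRho ((ω.2 - (B : ℂ)) / (2 * (A : ℂ))))
    (a := fun j ω => scaledOffDiag c t N a j ω.1) (b := fun j ω => scaledDiag c t N a j ω.1)
    hApos (fun j => (hofflim j).comp tendsto_fst) (fun j => (hdialim j).comp tendsto_fst)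
    (hFK.mono fun ω h => hC' _ h) hR (hFK.mono fun ω h => hρ _ h) hρX hrec hbd hne
  have hratio := tendsto_ratio_div_zpow
    (p := fun j ω => scaledQKrawtchouk c t N a ω.1 (ω.1 + j) ω.2)
    (ρ := fun ω : ℕ × ℂ => joukowskiRho ((ω.2 - (B : ℂ)) / (2 * (A : ℂ)))) hne
    (hFK.mono fun ω h => norm_pos_iff.1 (one_pos.trans (hR.trans_le (hρ _ h).1))) hstep m
  simpa only [add_zero] using hratio
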